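/- Call a set $E \subseteq \mathbb{C}$ a spider's web if $E$ is connected and there is a sequence $(G_k)_{k \in \mathbb{N}}$ of bounded simply connected domains in $\mathbb{C}$ such that $G_k \subseteq G_{k+1}$ and $\partial G_k \subseteq E$ for all $k$, and $\bigcup_k G_k = \mathbb{C}$. Let $f(z) = z + 1 + e^{-z}$, and let $f^n$ denote the $n$-th iterate of $f$. Then, for every integer $m \geq 0$, the set $$I\bigl(f, ((n+m)/2)\bigr) = \Bigl\{ z \in \mathbb{C} : |f^n(z)| \geq \frac{n+m}{2} \text{ for all integers } n \geq 1 \Bigr\}$$ contains a spider's web, that is, it has a subset which is a spider's web. -/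

import Mathlib

/-- An (infinite) spider's web in the plane: a connected set `E` for which there is an increasing
sequence of bounded simply connected domains whose boundaries lie in `E` and whose union is `ℂ`.
(A simply connected set in Mathlib is in particular nonempty and path connected.) -/
def IsSpidersWeb (E : Set ℂ) : Prop :=
  IsConnected E ∧
    ∃ G : ℕ → Set ℂ,
      (∀ n, IsOpen (G n) ∧ IsSimplyConnected (G n) ∧ Bornology.IsBounded (G n)) ∧
      (∀ n, G n ⊆ G (n + 1)) ∧
      (∀ n, frontier (G n) ⊆ E) ∧
      (⋃ n, G n) = Set.univ

/-- The set `I(f, (a_n))` of points `z` with `|f^n(z)| ≥ a_n` for every positive integer `n`,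
where `f^n` is the `n`-th iterate. If `a_n → ∞`, all these points escape to infinity. -/
def uniformEscapingSet (f : ℂ → ℂ) (a : ℕ → ℝ) : Set ℂ :=
  {z | ∀ n : ℕ, 1 ≤ n → a n ≤ ‖f^[n] z‖}

/-- Fatou's function `f(z) = z + 1 + e^{-z}`. -/
noncomputable def fatouFunction (z : ℂ) : ℂ :=
  z + 1 + Complex.exp (-z)

open Set Filter Topology Metric

/-! Two kinds of points visibly escape at linear speed: those in a right half-plane, where the
exponential is small, and those on the invariant lines at heights in `2πℤ`. Take radii `X n` in
`2πℕ` growing like an iterated exponential, and let `stayRegion X` be the points whose iterates stay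
in the half-strips of radius `X n` and at some time enter the corresponding square. A boundary point
must either have an iterate on a right edge or on a horizontal line of height `±X j`, or stay to the
left of the growing squares. In each case it escapes fast enough (`frontier_stayRegion_subset`).

These regions are bounded, since a point well to the left of the first square either leaves a
half-strip or stays left of every later square. They are simply connected
(`isSimplyConnected_stayRegion`): inverse branches of `fatouFunction` on the strips where `cos (im
z) < 0` lift deformations one level up. The maximum principle makes their complements connected, so
unicoherence of the plane makes their frontiers connected (`isPreconnected_frontier_stayRegion`). A
right half-plane meeting all these frontiers joins them into a web. -/

/-! ### Linear escape in a half-plane and on invariant lines. -/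

theorem fatouFunction_re (z : ℂ) :
    (fatouFunction z).re = z.re + 1 + Real.exp (-z.re) * Real.cos z.im := by
  simp [fatouFunction, Complex.exp_re]

theorem fatouFunction_im (z : ℂ) :
    (fatouFunction z).im = z.im - Real.exp (-z.re) * Real.sin z.im := by
  simp [fatouFunction, Complex.exp_im, sub_eq_add_neg]

theorem differentiable_fatouFunction : Differentiable ℂ fatouFunction := by
  unfold fatouFunction; fun_prop

theorem continuous_fatouFunction : Continuous fatouFunction :=
  differentiable_fatouFunction.continuous

theorem hasDerivAt_fatouFunction (z : ℂ) :
    HasDerivAt fatouFunction (1 - Complex.exp (-z)) z := by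
  have h := ((hasDerivAt_id z).add_const (1 : ℂ)).add (hasDerivAt_id z).neg.cexp
  exact h.congr_deriv (by simp [sub_eq_add_neg])

theorem add_half_le_fatouFunction_re {z : ℂ} (hz : 1 ≤ z.re) :
    z.re + 1 / 2 ≤ (fatouFunction z).re := by
  rw [fatouFunction_re]
  have h1 : Real.exp (-z.re) ≤ 1 / 2 := by
    have h2 : Real.exp z.re ≥ 2 := by linarith [Real.add_one_le_exp z.re]
    rw [Real.exp_neg]
    exact (inv_anti₀ (by norm_num) h2).trans (by norm_num)
  nlinarith [Real.neg_one_le_cos z.im, Real.exp_pos (-z.re)]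

/-- Points far to the right drift to the right at linear speed. -/
theorem iterate_re_of_right {z : ℂ} (hz : 1 ≤ z.re) (n : ℕ) :
    z.re + n / 2 ≤ (fatouFunction^[n] z).re := by
  induction n with
  | zero => simp
  | succ n ih =>
    rw [Function.iterate_succ_apply']
    have hn : (0 : ℝ) ≤ n := n.cast_nonneg
    have := add_half_le_fatouFunction_re (z := fatouFunction^[n] z) (by linarith)
    push_cast
    linarith

/-- Here `exp (-z)` is a positive real, and `x + 1 + exp (-x) ≥ 2` for every real `x`: one step
suffices to land in the right half-plane, however far left the start. -/
theorem fatouFunction_line {z : ℂ} {k : ℤ} (hz : z.im = k * (2 * Real.pi)) :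
    (fatouFunction z).im = k * (2 * Real.pi) ∧ z.re + 1 ≤ (fatouFunction z).re ∧
      2 ≤ (fatouFunction z).re := by
  have hs : Real.sin z.im = 0 := by rw [hz]; simpa using Real.sin_add_int_mul_two_pi 0 k
  have hc : Real.cos z.im = 1 := by rw [hz]; exact Real.cos_int_mul_two_pi k
  rw [fatouFunction_re, fatouFunction_im, hs, hc]
  refine ⟨by simp [hz], ?_, ?_⟩
  · linarith [Real.exp_pos (-z.re)]
  · linarith [Real.add_one_le_exp (-z.re)]

/-- The horizontal lines at heights in `2πℤ` are invariant, and points on them escape at linear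
speed. -/
theorem iterate_line {z : ℂ} {k : ℤ} (hz : z.im = k * (2 * Real.pi)) (n : ℕ) :
    (fatouFunction^[n + 1] z).im = k * (2 * Real.pi) ∧
      (n : ℝ) + 2 ≤ (fatouFunction^[n + 1] z).re := by
  induction n with
  | zero => simp [(fatouFunction_line hz).1, (fatouFunction_line hz).2.2]
  | succ n ih =>
    rw [Function.iterate_succ_apply']
    have := fatouFunction_line ih.1
    refine ⟨this.1, ?_⟩
    push_cast
    linarith [this.2.1]

/-! ### Radius sequences and the regions they define. -/

/-- A radius sequence: multiples of `2π` growing like an iterated exponential. -/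
structure IsRadiusSeq (X : ℕ → ℝ) : Prop where
  exists_nat : ∀ n, ∃ k : ℕ, X n = k * (2 * Real.pi)
  six_le : ∀ n, 6 ≤ X n
  exp_add_le : ∀ n, Real.exp (X n) + X n + 1 ≤ X (n + 1)
  le_exp_add : ∀ n, X (n + 1) ≤ Real.exp (X n) + X n + 8

theorem IsRadiusSeq.shift {X : ℕ → ℝ} (hX : IsRadiusSeq X) : IsRadiusSeq (fun n => X (n + 1)) :=
  ⟨fun _ => hX.1 _, fun _ => hX.2 _, fun _ => hX.3 _, fun _ => hX.4 _⟩

theorem IsRadiusSeq.add_one_le {X : ℕ → ℝ} (hX : IsRadiusSeq X) (n : ℕ) : X n + 1 ≤ X (n + 1) := by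
  linarith [hX.exp_add_le n, Real.exp_pos (X n)]

theorem IsRadiusSeq.add_le {X : ℕ → ℝ} (hX : IsRadiusSeq X) (n : ℕ) : X 0 + n ≤ X n := by
  induction n with
  | zero => simp
  | succ n ih => push_cast; linarith [hX.add_one_le n]

/-- A horizontal half-strip, open to the left. -/
def halfStrip (r : ℝ) : Set ℂ := {z | z.re < r ∧ |z.im| < r}

/-- The open square with side `2r` centred at the origin. -/
def box (r : ℝ) : Set ℂ := {z | z ∈ halfStrip r ∧ -r < z.re}

theorem isOpen_halfStrip (r : ℝ) : IsOpen (halfStrip r) :=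
  (isOpen_lt Complex.continuous_re continuous_const).inter
    (isOpen_lt Complex.continuous_im.abs continuous_const)

theorem isOpen_box (r : ℝ) : IsOpen (box r) :=
  (isOpen_halfStrip r).inter (isOpen_lt continuous_const Complex.continuous_re)

theorem box_subset_halfStrip (r : ℝ) : box r ⊆ halfStrip r := fun _ hz => hz.1

theorem halfStrip_mono {r s : ℝ} (h : r ≤ s) : halfStrip r ⊆ halfStrip s :=
  fun _ hz => ⟨hz.1.trans_le h, hz.2.trans_le h⟩

theorem box_mono {r s : ℝ} (h : r ≤ s) : box r ⊆ box s :=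
  fun _ hz => ⟨halfStrip_mono h hz.1, by linarith [hz.2]⟩

/-- The points whose first `n` iterates lie in the half-strips given by `X` and whose `n`-th
iterate lies in the corresponding square. -/
def stayDomain : ℕ → (ℕ → ℝ) → Set ℂ
  | 0, X => box (X 0)
  | n + 1, X => halfStrip (X 0) ∩ fatouFunction ⁻¹' stayDomain n (fun i => X (i + 1))

theorem isOpen_stayDomain (n : ℕ) (X : ℕ → ℝ) : IsOpen (stayDomain n X) := by
  induction n generalizing X with
  | zero => exact isOpen_box _
  | succ n ih => exact (isOpen_halfStrip _).inter ((ih _).preimage continuous_fatouFunction)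

theorem mem_stayDomain_iff {n : ℕ} {X : ℕ → ℝ} {z : ℂ} :
    z ∈ stayDomain n X ↔
      (∀ j < n, fatouFunction^[j] z ∈ halfStrip (X j)) ∧ fatouFunction^[n] z ∈ box (X n) := by
  induction n generalizing X z with
  | zero => simp [stayDomain]
  | succ n ih =>
    simp only [stayDomain, mem_inter_iff, mem_preimage, ih, Nat.forall_lt_succ_left,
      Function.iterate_succ_apply, Function.iterate_zero, id, and_assoc]

theorem stayDomain_subset_halfStrip (n : ℕ) (X : ℕ → ℝ) : stayDomain n X ⊆ halfStrip (X 0) := by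
  cases n with
  | zero => exact box_subset_halfStrip _
  | succ n => exact inter_subset_left

theorem stayDomain_mono_seq (n : ℕ) {X Y : ℕ → ℝ} (h : ∀ i, X i ≤ Y i) :
    stayDomain n X ⊆ stayDomain n Y := by
  intro z hz
  rw [mem_stayDomain_iff] at hz ⊢
  exact ⟨fun j hj => halfStrip_mono (h j) (hz.1 j hj), box_mono (h n) hz.2⟩

theorem fatouFunction_mem_box {r s : ℝ} (hs : Real.exp r + r + 1 ≤ s) {z : ℂ}
    (hz : z ∈ halfStrip r) (hz' : -r ≤ z.re) : fatouFunction z ∈ box s := by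
  obtain ⟨h1, h2⟩ := hz
  have he : Real.exp (-z.re) ≤ Real.exp r := Real.exp_le_exp.2 (by linarith)
  have he0 := Real.exp_pos (-z.re)
  have hc := Real.abs_cos_le_one z.im
  have hsn := Real.abs_sin_le_one z.im
  have hc' : |Real.exp (-z.re) * Real.cos z.im| ≤ Real.exp r := by
    rw [abs_mul, abs_of_pos he0]; nlinarith [abs_nonneg (Real.cos z.im)]
  have hs' : |Real.exp (-z.re) * Real.sin z.im| ≤ Real.exp r := by
    rw [abs_mul, abs_of_pos he0]; nlinarith [abs_nonneg (Real.sin z.im)]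
  rw [abs_le] at hc'
  refine ⟨⟨?_, ?_⟩, ?_⟩
  · rw [fatouFunction_re]; linarith
  · rw [fatouFunction_im]
    exact (abs_sub _ _).trans_lt (by linarith)
  · rw [fatouFunction_re]; linarith

theorem stayDomain_subset_succ {X : ℕ → ℝ} (hX : IsRadiusSeq X) (n : ℕ) :
    stayDomain n X ⊆ stayDomain (n + 1) X := by
  intro z hz
  rw [mem_stayDomain_iff] at hz ⊢
  refine ⟨fun j hj => ?_, ?_⟩
  · rcases Nat.lt_succ_iff_lt_or_eq.1 hj with h | rfl
    · exact hz.1 j h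
    · exact hz.2.1
  · rw [Function.iterate_succ_apply']
    exact fatouFunction_mem_box (hX.exp_add_le n) hz.2.1 hz.2.2.le

theorem stayDomain_mono {X : ℕ → ℝ} (hX : IsRadiusSeq X) : Monotone (stayDomain · X) :=
  monotone_nat_of_le_succ (stayDomain_subset_succ hX)

/-! ### Boundedness of the regions. -/

theorem eight_mul_le_exp {x : ℝ} (hx : 6 ≤ x) : 8 * (x + 9) ≤ Real.exp x := by
  have h1 : Real.exp 6 = Real.exp 1 ^ 6 := by rw [← Real.exp_nat_mul]; norm_num
  have h2 : (2.7 : ℝ) ^ 6 ≤ Real.exp 1 ^ 6 := by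
    gcongr; linarith [Real.exp_one_gt_d9]
  have h3 : Real.exp x = Real.exp 6 * Real.exp (x - 6) := by rw [← Real.exp_add]; ring_nf
  have h4 := Real.add_one_le_exp (x - 6)
  rw [h3, h1]
  norm_num at h2
  nlinarith

/-- A point of a half-strip lying to the left of the square is either mapped out of the next
half-strip or again to the left of the next square. -/
theorem fatouFunction_re_le {r s : ℝ} (hr : 6 ≤ r) (hs : s ≤ Real.exp r + r + 8) {z : ℂ}
    (hz : z ∈ halfStrip r) (hz' : z.re ≤ -r - 1) (hfz : fatouFunction z ∈ halfStrip s) :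
    (fatouFunction z).re ≤ -s - 1 := by
  have h1 : ‖Complex.exp (-z)‖ ≤ ‖fatouFunction z‖ + (‖z‖ + 1) := by
    have : Complex.exp (-z) = fatouFunction z - (z + 1) := by unfold fatouFunction; ring
    rw [this]
    refine (norm_sub_le _ _).trans ?_
    gcongr
    simpa using norm_add_le z 1
  rw [Complex.norm_exp, Complex.neg_re] at h1
  have h2 := Complex.norm_le_abs_re_add_abs_im z
  have h3 := Complex.norm_le_abs_re_add_abs_im (fatouFunction z)
  have h4 : |z.re| = -z.re := abs_of_nonpos (by linarith)
  have h5 := hz.2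
  have h6 := hfz.2
  have h7 : Real.exp (-z.re) = Real.exp r * Real.exp 1 * Real.exp (-z.re - r - 1) := by
    rw [← Real.exp_add, ← Real.exp_add]; ring_nf
  have h8 := Real.add_one_le_exp (-z.re - r - 1)
  have h9 := eight_mul_le_exp hr
  have h10 := Real.exp_one_gt_d9
  -- One unit beyond the square the exponential gains a factor `e`. What matters is `e > 2`: the
  -- bounds on both coordinates of the image cost about `2 * s`, hence about `2 * exp r`.
  have h11 : 2.7 * Real.exp r ≤ Real.exp r * Real.exp 1 := by nlinarith [Real.exp_pos r]
  have h12 : 2.7 * Real.exp r + (-z.re - r - 1) ≤ Real.exp (-z.re) := by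
    rw [h7]
    nlinarith [Real.exp_pos r]
  have h13 : s + 1 < |(fatouFunction z).re| := by
    linarith
  rcases lt_abs.1 h13 with h | h
  · linarith [hfz.1]
  · linarith

/-- A point further left would have all its iterates left of the squares, including the last, which
lies in its square. -/
theorem re_of_mem_stayDomain {X : ℕ → ℝ} (hX : IsRadiusSeq X) {n : ℕ} {z : ℂ}
    (hz : z ∈ stayDomain n X) : -X 0 - 1 < z.re := by
  induction n generalizing X z with
  | zero => linarith [hz.2]
  | succ n ih =>
    by_contra! h
    have h1 := fatouFunction_re_le (hX.six_le 0) (hX.le_exp_add 0) hz.1 h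
      (stayDomain_subset_halfStrip _ _ hz.2)
    linarith [ih hX.shift hz.2]

/-- The points that stay in the half-strips given by `X` and eventually in the squares. -/
def stayRegion (X : ℕ → ℝ) : Set ℂ := ⋃ n, stayDomain n X

theorem isOpen_stayRegion (X : ℕ → ℝ) : IsOpen (stayRegion X) :=
  isOpen_iUnion fun n => isOpen_stayDomain n X

theorem stayRegion_mono {X Y : ℕ → ℝ} (h : ∀ i, X i ≤ Y i) : stayRegion X ⊆ stayRegion Y :=
  iUnion_mono fun n => stayDomain_mono_seq n h

theorem box_subset_stayRegion (X : ℕ → ℝ) : box (X 0) ⊆ stayRegion X :=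
  subset_iUnion (stayDomain · X) 0

theorem re_of_mem_stayRegion {X : ℕ → ℝ} (hX : IsRadiusSeq X) {z : ℂ} (hz : z ∈ stayRegion X) :
    -X 0 - 1 < z.re := by
  obtain ⟨n, hn⟩ := mem_iUnion.1 hz
  exact re_of_mem_stayDomain hX hn

theorem stayRegion_subset_halfStrip (X : ℕ → ℝ) : stayRegion X ⊆ halfStrip (X 0) :=
  iUnion_subset fun n => stayDomain_subset_halfStrip n X

theorem isBounded_stayRegion {X : ℕ → ℝ} (hX : IsRadiusSeq X) :
    Bornology.IsBounded (stayRegion X) := by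
  refine (isBounded_iff_forall_norm_le).2 ⟨(X 0 + 1) + X 0, fun z hz => ?_⟩
  have h1 := re_of_mem_stayRegion hX hz
  have h2 := stayRegion_subset_halfStrip X hz
  refine (Complex.norm_le_abs_re_add_abs_im z).trans (add_le_add ?_ h2.2.le)
  exact abs_le.2 ⟨by linarith, by linarith [h2.1]⟩

theorem iterate_mem_halfStrip {X : ℕ → ℝ} (hX : IsRadiusSeq X) {z : ℂ} (hz : z ∈ stayRegion X)
    (j : ℕ) : fatouFunction^[j] z ∈ halfStrip (X j) := by
  obtain ⟨n, hn⟩ := mem_iUnion.1 hz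
  exact (mem_stayDomain_iff.1 (stayDomain_mono hX (le_max_left n (j + 1)) hn)).1 j
    (lt_max_of_lt_right j.lt_succ_self)

/-! ### Frontier points escape. -/

theorem abs_eq_mul_two_pi {r : ℝ} (hr : ∃ k : ℕ, r = k * (2 * Real.pi)) {y : ℝ} (hy : |y| = r) :
    ∃ k : ℤ, y = k * (2 * Real.pi) := by
  obtain ⟨k, rfl⟩ := hr
  rcases eq_or_eq_neg_of_abs_eq hy with h | h
  · exact ⟨k, by simpa using h⟩
  · exact ⟨-k, by simpa using h⟩

theorem uniformEscaping_of_right {m : ℕ} {z : ℂ} (h1 : 1 ≤ z.re) (hm : (m : ℝ) ≤ z.re) :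
    z ∈ uniformEscapingSet fatouFunction (fun n : ℕ => ((n : ℝ) + (m : ℝ)) / 2) := by
  intro n _
  have := iterate_re_of_right h1 n
  have := Complex.re_le_norm (fatouFunction^[n] z)
  have : (0 : ℝ) ≤ m := m.cast_nonneg
  linarith

theorem frontier_stayRegion_subset {X : ℕ → ℝ} (hX : IsRadiusSeq X) {m : ℕ} (hm : (m : ℝ) ≤ X 0) :
    frontier (stayRegion X) ⊆
      uniformEscapingSet fatouFunction (fun n : ℕ => ((n : ℝ) + (m : ℝ)) / 2) := by
  intro z hz n _
  rw [(isOpen_stayRegion X).frontier_eq] at hz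
  obtain ⟨hzc, hzn⟩ := hz
  have hcl : ∀ j, (fatouFunction^[j] z).re ≤ X j ∧ |(fatouFunction^[j] z).im| ≤ X j := by
    intro j
    have hc : IsClosed {w : ℂ | w.re ≤ X j ∧ |w.im| ≤ X j} :=
      (isClosed_le Complex.continuous_re continuous_const).inter
        (isClosed_le Complex.continuous_im.abs continuous_const)
    refine (hc.preimage (continuous_fatouFunction.iterate j)).closure_subset_iff.2 ?_ hzc
    intro w hw
    have := iterate_mem_halfStrip hX hw j
    exact ⟨this.1.le, this.2.le⟩
  have hm0 : (0 : ℝ) ≤ m := m.cast_nonneg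
  -- Either the orbit is still in the open half-strips at time `n`, so it lies left of the square
  -- there, or some earlier iterate lies on an edge: a right edge or an invariant line.
  by_cases h : ∀ j ≤ n, fatouFunction^[j] z ∈ halfStrip (X j)
  · have h1 : fatouFunction^[n] z ∉ box (X n) := fun h1 =>
      hzn (mem_iUnion.2 ⟨n, mem_stayDomain_iff.2 ⟨fun j hj => h j hj.le, h1⟩⟩)
    have h2 : (fatouFunction^[n] z).re ≤ -X n := by
      by_contra! h2
      exact h1 ⟨h n le_rfl, h2⟩
    have h3 := (neg_le_abs _).trans (Complex.abs_re_le_norm (fatouFunction^[n] z))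
    have h4 := hX.add_le n
    have h5 : (0 : ℝ) ≤ n := n.cast_nonneg
    linarith
  · push Not at h
    obtain ⟨j, hj, hjn⟩ := h
    obtain ⟨l, rfl⟩ := Nat.exists_eq_add_of_le' hj
    have h4 := hX.add_le j
    have h5 : (0 : ℝ) ≤ j := j.cast_nonneg
    have h6 : (0 : ℝ) ≤ l := l.cast_nonneg
    have h7 := hX.six_le j
    rw [Function.iterate_add_apply]
    set w := fatouFunction^[j] z with hw
    by_cases hre : w.re < X j
    · have him : |w.im| = X j := by
        refine le_antisymm (hcl j).2 ?_
        by_contra! hlt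
        exact hjn ⟨hre, hlt⟩
      obtain ⟨k, hk⟩ := abs_eq_mul_two_pi (hX.exists_nat j) him
      cases l with
      | zero =>
        have := Complex.abs_im_le_norm w
        simp only [Function.iterate_zero, id]
        push_cast
        linarith
      | succ l =>
        obtain ⟨h8, h9⟩ := iterate_line hk l
        have h10 := Complex.abs_im_le_norm (fatouFunction^[l + 1] w)
        have h11 := Complex.re_le_norm (fatouFunction^[l + 1] w)
        -- The norm dominates both the height `X j` and the real part, hence their mean; this gives
        -- the factor `1 / 2`.
        rw [h8, ← hk, him] at h10
        push_cast
        linarith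
    · have h8 := iterate_re_of_right (z := w) (by linarith) l
      have h11 := Complex.re_le_norm (fatouFunction^[l] w)
      push_cast
      linarith

/-! ### Unicoherence of the plane. -/

/-- The plane is unicoherent. -/
theorem isPreconnected_inter_of_union_eq_univ {A B : Set ℂ} (hA : IsClosed A) (hB : IsClosed B)
    (hAc : IsPreconnected A) (hBc : IsPreconnected B) (hAB : A ∪ B = univ) :
    IsPreconnected (A ∩ B) := by
  classical
  rw [isPreconnected_closed_iff]
  intro P Q hP hQ hPQ hPne hQne
  by_contra hne
  rw [not_nonempty_iff_eq_empty] at hne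
  set P' := A ∩ B ∩ P
  set Q' := A ∩ B ∩ Q
  have hdisj : Disjoint P' Q' := by
    rw [Set.disjoint_iff_inter_eq_empty, ← hne]
    ext z; simp only [P', Q', mem_inter_iff]; tauto
  obtain ⟨u, hu0, hu1, -⟩ := exists_continuous_zero_one_of_isClosed ((hA.inter hB).inter hP)
    ((hA.inter hB).inter hQ) hdisj
  -- Glue `exp (iπu)` on `A` to `exp (-iπu)` on `B`; they agree on `A ∩ B`, where `u` is 0 or 1. A
  -- global logarithm `θ` would change by `iπ` from `p` to `q` when computed through `A`, and by
  -- `-iπ` through `B`.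
  let a : ℂ → ℂ := fun z => (u z : ℂ) * (Real.pi * Complex.I)
  have ha : Continuous a := by fun_prop
  let g : ℂ → ℂ := fun z => if z ∈ A then Complex.exp (a z) else Complex.exp (-a z)
  have hgA : EqOn g (fun z => Complex.exp (a z)) A := fun z hz => by simp [g, hz]
  have hgB : EqOn g (fun z => Complex.exp (-a z)) B := by
    intro z hz
    by_cases hzA : z ∈ A
    · rcases hPQ ⟨hzA, hz⟩ with h | h
      · have : u z = 0 := hu0 ⟨⟨hzA, hz⟩, h⟩
        simp [g, hzA, a, this]
      · have : u z = 1 := hu1 ⟨⟨hzA, hz⟩, h⟩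
        simp [g, hzA, a, this, Complex.exp_neg]
    · simp [g, hzA]
  have hg : ContinuousOn g univ := by
    rw [← hAB]
    refine ContinuousOn.union_of_isClosed ?_ ?_ hA hB
    · exact (by fun_prop : Continuous fun z => Complex.exp (a z)).continuousOn.congr hgA
    · exact (by fun_prop : Continuous fun z => Complex.exp (-a z)).continuousOn.congr hgB
  have hg0 : (0 : ℂ) ∉ g '' univ := by
    rintro ⟨z, -, hz⟩
    by_cases hzA : z ∈ A <;> simp [g, hzA] at hz
  have huniv : IsSimplyConnected (univ : Set ℂ) := by
    have := (convex_univ (𝕜 := ℝ) (E := ℂ)).contractibleSpace univ_nonempty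
    exact SimplyConnectedSpace.ofContractible _
  obtain ⟨θ, hθ, hθg⟩ := Complex.exists_continuousOn_eqOn_exp_comp huniv isOpen_univ hg hg0
  -- Two continuous logarithms differ by a continuous function with values in `2πiℤ`, which is
  -- constant on a connected set.
  have key : ∀ (C : Set ℂ) (b : ℂ → ℂ), IsPreconnected C → Continuous b →
      EqOn g (fun z => Complex.exp (b z)) C → ∀ z ∈ C, ∀ w ∈ C, θ z - b z = θ w - b w := by
    intro C b hC hb hgb z hz w hw
    have hcont : ContinuousOn (fun z => (θ z - b z) / (2 * Real.pi * Complex.I)) C :=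
      ((hθ.mono (subset_univ _)).sub hb.continuousOn).div_const _
    have hpi : (2 * Real.pi * Complex.I : ℂ) ≠ 0 := Complex.two_pi_I_ne_zero
    have hint : ∀ z ∈ C, ∃ k : ℤ, (θ z - b z) / (2 * Real.pi * Complex.I) = k := by
      intro z hz
      have h1 : Complex.exp (θ z) = Complex.exp (b z) := (hθg (mem_univ z)).trans (hgb hz)
      obtain ⟨k, hk⟩ := Complex.exp_eq_exp_iff_exists_int.1 h1
      exact ⟨k, by rw [hk]; field_simp; ring⟩
    have hre : ContinuousOn (fun z => ((θ z - b z) / (2 * Real.pi * Complex.I)).re) C :=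
      Complex.continuous_re.comp_continuousOn hcont
    have himg : ((fun z => ((θ z - b z) / (2 * Real.pi * Complex.I)).re) '' C).Subsingleton := by
      refine (countable_range ((↑) : ℤ → ℝ)).isTotallyDisconnected _ ?_ (hC.image _ hre)
      rintro _ ⟨z, hz, rfl⟩
      obtain ⟨k, hk⟩ := hint z hz
      exact ⟨k, by simp [hk]⟩
    obtain ⟨k, hk⟩ := hint z hz
    obtain ⟨l, hl⟩ := hint w hw
    have h2 := himg (mem_image_of_mem _ hz) (mem_image_of_mem _ hw)
    simp only [hk, hl, Complex.intCast_re, Int.cast_inj] at h2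
    rw [div_eq_iff hpi] at hk hl
    rw [hk, hl, h2]
  obtain ⟨p, hp, hpP⟩ := hPne
  obtain ⟨q, hq, hqQ⟩ := hQne
  have h1 := key A a hAc ha hgA p hp.1 q hq.1
  have h2 := key B (fun z => -a z) hBc ha.neg hgB p hp.2 q hq.2
  have hup : u p = 0 := hu0 ⟨hp, hpP⟩
  have huq : u q = 1 := hu1 ⟨hq, hqQ⟩
  simp only [a, hup, huq, Complex.ofReal_zero, Complex.ofReal_one] at h1 h2
  have h3 : (Real.pi * Complex.I : ℂ) = 0 := by linear_combination (h1 - h2) / 2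
  simp [Real.pi_ne_zero] at h3

/-! ### Maximum principle, connected complements and frontiers. -/

/-- Maximum modulus for `exp ∘ g`; compactness of the frontier keeps the inequality strict. -/
theorem re_lt_of_frontier {g : ℂ → ℂ} (hg : Differentiable ℂ g) {U : Set ℂ}
    (hU : Bornology.IsBounded U) {r : ℝ} (hr : ∀ z ∈ frontier U, (g z).re < r) {z : ℂ}
    (hz : z ∈ U) : (g z).re < r := by
  obtain ⟨C, hC, hCr⟩ : ∃ C < Real.exp r, ∀ w ∈ frontier U, ‖Complex.exp (g w)‖ ≤ C := by
    have hcomp : IsCompact (frontier U) :=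
      isCompact_of_isClosed_isBounded isClosed_frontier (hU.closure.subset frontier_subset_closure)
    rcases (frontier U).eq_empty_or_nonempty with h | h
    · exact ⟨0, Real.exp_pos _, by simp [h]⟩
    · have hcont : Continuous fun w => ‖Complex.exp (g w)‖ := by
        have := hg.continuous
        fun_prop
      obtain ⟨w, hw, hmax⟩ := hcomp.exists_isMaxOn h hcont.continuousOn
      exact ⟨_, by simpa [Complex.norm_exp] using hr w hw, hmax⟩
  have := (Complex.norm_le_of_forall_mem_frontier_norm_le hU hg.cexp.diffContOnCl hCr
    (subset_closure hz)).trans_lt hC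
  rwa [Complex.norm_exp, Real.exp_lt_exp] at this

theorem mem_halfStrip_of_frontier {g : ℂ → ℂ} (hg : Differentiable ℂ g) {U : Set ℂ}
    (hU : Bornology.IsBounded U) {r : ℝ} (hr : ∀ z ∈ frontier U, g z ∈ halfStrip r) {z : ℂ}
    (hz : z ∈ U) : g z ∈ halfStrip r := by
  refine ⟨re_lt_of_frontier hg hU (fun w hw => (hr w hw).1) hz, abs_lt.2 ⟨?_, ?_⟩⟩
  · have := re_lt_of_frontier (hg.const_mul Complex.I) hU (r := r)
      (fun w hw => by have := abs_lt.1 (hr w hw).2; simp; linarith) hz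
    simp at this
    linarith
  · have := re_lt_of_frontier (hg.const_mul (-Complex.I)) hU (r := r)
      (fun w hw => by have := abs_lt.1 (hr w hw).2; simp; linarith) hz
    simpa using this

theorem subset_stayDomain_of_frontier {X : ℕ → ℝ} {n : ℕ} {U : Set ℂ} (hU : Bornology.IsBounded U)
    (h : frontier U ⊆ stayDomain n X) : U ⊆ stayDomain n X := by
  intro z hz
  have hd := fun j => differentiable_fatouFunction.iterate j
  refine mem_stayDomain_iff.2 ⟨fun j hj => mem_halfStrip_of_frontier (hd j) hU
    (fun w hw => (mem_stayDomain_iff.1 (h hw)).1 j hj) hz, mem_halfStrip_of_frontier (hd n) hU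
    (fun w hw => (mem_stayDomain_iff.1 (h hw)).2.1) hz, ?_⟩
  have := re_lt_of_frontier (hd n).neg hU (r := X n)
    (fun w hw => by have := (mem_stayDomain_iff.1 (h hw)).2.2; simp; linarith) hz
  simp at this
  linarith

theorem isPreconnected_compl_closedBall {R : ℝ} (hR : 0 < R) :
    IsPreconnected (closedBall (0 : ℂ) R)ᶜ := by
  have h : (closedBall (0 : ℂ) R)ᶜ = Complex.exp '' {z | Real.log R < z.re} := by
    ext z
    simp only [mem_compl_iff, mem_closedBall_zero_iff, not_le, mem_image, mem_ofPred_eq]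
    constructor
    · intro hz
      have hz0 : z ≠ 0 := norm_pos_iff.1 (hR.trans hz)
      exact ⟨Complex.log z, by rw [Complex.log_re]; exact Real.log_lt_log hR hz,
        Complex.exp_log hz0⟩
    · rintro ⟨w, hw, rfl⟩
      rwa [Complex.norm_exp, ← Real.log_lt_iff_lt_exp hR]
  rw [h]
  exact (convex_halfSpace_re_gt _).isPreconnected.image _ Complex.continuous_exp.continuousOn

/-- A separated bounded piece of the complement would lie in a bounded open `U` with frontier in the
region. By compactness one `stayDomain n X` contains that frontier, hence all of `U`, by the maximum
principle. -/
theorem isPreconnected_compl_stayRegion {X : ℕ → ℝ} (hX : IsRadiusSeq X) :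
    IsPreconnected (stayRegion X)ᶜ := by
  have hcl : IsClosed (stayRegion X)ᶜ := (isOpen_stayRegion X).isClosed_compl
  obtain ⟨R, hR0, hR⟩ := (isBounded_stayRegion hX).subset_closedBall_lt 0 0
  have hO := isPreconnected_compl_closedBall hR0
  have hOS : (closedBall (0 : ℂ) R)ᶜ ⊆ (stayRegion X)ᶜ := compl_subset_compl.2 hR
  -- `Q` is the piece containing the exterior of a large disc.
  have main : ∀ P Q : Set ℂ, IsClosed P → IsClosed Q → (stayRegion X)ᶜ ⊆ P ∪ Q →
      ((stayRegion X)ᶜ ∩ P).Nonempty → (stayRegion X)ᶜ ∩ (P ∩ Q) = ∅ →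
      (closedBall (0 : ℂ) R)ᶜ ⊆ Q → False := by
    intro P Q hP hQ hPQ ⟨p, hpS, hpP⟩ he hOQ
    have hdisj : (stayRegion X)ᶜ ∩ P ⊆ ((stayRegion X)ᶜ ∩ Q)ᶜ := by
      intro z hz hz'
      exact (he.subset ⟨hz.1, hz.2, hz'.2⟩ : z ∈ (∅ : Set ℂ))
    obtain ⟨U, hUo, hPU, hUQ⟩ := normal_exists_closure_subset (hcl.inter hP)
      (hcl.inter hQ).isOpen_compl hdisj
    have hUb : Bornology.IsBounded U := by
      refine isBounded_closedBall.subset (t := closedBall (0 : ℂ) R) fun z hz => ?_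
      by_contra hzR
      exact hUQ (subset_closure hz) ⟨hOS hzR, hOQ hzR⟩
    have hfr : frontier U ⊆ stayRegion X := by
      intro z hz
      by_contra hzS
      rw [hUo.frontier_eq] at hz
      rcases hPQ hzS with h | h
      · exact hz.2 (hPU ⟨hzS, h⟩)
      · exact hUQ hz.1 ⟨hzS, h⟩
    have hcomp : IsCompact (frontier U) := isCompact_of_isClosed_isBounded isClosed_frontier
      (hUb.closure.subset frontier_subset_closure)
    obtain ⟨n, hn⟩ := hcomp.elim_directed_cover _ (fun n => isOpen_stayDomain n X) hfr
      (stayDomain_mono hX).directed_le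
    exact hpS (mem_iUnion.2 ⟨n, subset_stayDomain_of_frontier hUb hn (hPU ⟨hpS, hpP⟩)⟩)
  rw [isPreconnected_closed_iff]
  intro P Q hP hQ hPQ hPne hQne
  by_contra hne
  rw [not_nonempty_iff_eq_empty] at hne
  have hO' : (closedBall (0 : ℂ) R)ᶜ ∩ (P ∩ Q) = ∅ :=
    subset_empty_iff.1 ((inter_subset_inter_left _ hOS).trans hne.subset)
  rcases isPreconnected_iff_subset_of_disjoint_closed.1 hO P Q hP hQ (hOS.trans hPQ) hO' with h | h
  · exact main Q P hQ hP (by rwa [union_comm]) hQne (by rwa [inter_comm Q P]) h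
  · exact main P Q hP hQ hPQ hPne hne h

theorem isPreconnected_frontier_stayRegion {X : ℕ → ℝ} (hX : IsRadiusSeq X)
    (hc : IsPreconnected (stayRegion X)) : IsPreconnected (frontier (stayRegion X)) := by
  rw [(isOpen_stayRegion X).frontier_eq, sdiff_eq]
  refine isPreconnected_inter_of_union_eq_univ isClosed_closure
    (isOpen_stayRegion X).isClosed_compl hc.closure (isPreconnected_compl_stayRegion hX) ?_
  exact eq_univ_of_forall fun z => (em (z ∈ stayRegion X)).imp (fun h => subset_closure h) id

/-- A loop is compact, so it lies in one `U n` and is contracted there. -/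
theorem isSimplyConnected_iUnion_of_isOpen {X : Type*} [TopologicalSpace X] {U : ℕ → Set X}
    (hmono : Monotone U) (ho : ∀ n, IsOpen (U n)) (hs : ∀ n, IsSimplyConnected (U n)) :
    IsSimplyConnected (⋃ n, U n) := by
  rw [isSimplyConnected_iff_exists_homotopy_refl_forall_mem]
  constructor
  · obtain ⟨x, hx⟩ := (hs 0).nonempty
    refine ⟨x, mem_iUnion.2 ⟨0, hx⟩, fun {y} hy => ?_⟩
    obtain ⟨n, hn⟩ := mem_iUnion.1 hy
    exact ((hs n).isPathConnected.joinedIn x (hmono n.zero_le hx) y hn).mono (subset_iUnion U n)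
  · intro x p hp
    have hcomp : IsCompact (range p) := isCompact_range p.continuous
    obtain ⟨n, hn⟩ := hcomp.elim_directed_cover U ho (by rintro _ ⟨t, rfl⟩; exact hp t)
      hmono.directed_le
    obtain ⟨F, hF⟩ := (isSimplyConnected_iff_exists_homotopy_refl_forall_mem.1 (hs n)).2 x p
      fun t => hn (mem_range_self t)
    exact ⟨F, fun t => mem_iUnion.2 ⟨n, hF t⟩⟩

/-! ### Inverse branches on left strips. -/

/-- A component of the set where the cosine of the imaginary part is negative. -/
def leftStrip (j : ℤ) : Set ℂ :=
  {z | j * (2 * Real.pi) + Real.pi / 2 < z.im ∧ z.im < j * (2 * Real.pi) + 3 * Real.pi / 2}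

theorem isOpen_leftStrip (j : ℤ) : IsOpen (leftStrip j) :=
  (isOpen_lt continuous_const Complex.continuous_im).inter
    (isOpen_lt Complex.continuous_im continuous_const)

theorem convex_leftStrip (j : ℤ) : Convex ℝ (leftStrip j) :=
  (convex_halfSpace_im_gt _).inter (convex_halfSpace_im_lt _)

theorem cos_im_neg_of_mem_leftStrip {j : ℤ} {z : ℂ} (hz : z ∈ leftStrip j) :
    Real.cos z.im < 0 := by
  rw [← Real.cos_sub_int_mul_two_pi z.im j]
  exact Real.cos_neg_of_pi_div_two_lt_of_lt (by linarith [hz.1]) (by linarith [hz.2])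

theorem floor_of_mem_leftStrip {j : ℤ} {z : ℂ} (hz : z ∈ leftStrip j) :
    ⌊z.im / (2 * Real.pi)⌋ = j := by
  have hpi := Real.pi_pos
  rw [Int.floor_eq_iff, le_div_iff₀ (by positivity), div_lt_iff₀ (by positivity)]
  constructor <;> nlinarith [hz.1, hz.2]

theorem exists_mem_leftStrip {z : ℂ} (hz : Real.cos z.im < 0) : ∃ j, z ∈ leftStrip j := by
  have hpi := Real.pi_pos
  set j := ⌊z.im / (2 * Real.pi)⌋
  have h1 : j * (2 * Real.pi) ≤ z.im := (le_div_iff₀ (by positivity)).1 (Int.floor_le _)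
  have h2 : z.im < (j + 1) * (2 * Real.pi) :=
    (div_lt_iff₀ (by positivity)).1 (Int.lt_floor_add_one _)
  refine ⟨j, ?_, ?_⟩
  · by_contra! h
    rw [← Real.cos_sub_int_mul_two_pi z.im j] at hz
    exact hz.not_ge (Real.cos_nonneg_of_neg_pi_div_two_le_of_le (by linarith) (by linarith))
  · by_contra! h
    rw [← Real.cos_sub_int_mul_two_pi z.im (j + 1)] at hz
    push_cast at hz
    exact hz.not_ge (Real.cos_nonneg_of_neg_pi_div_two_le_of_le (by linarith) (by linarith))

theorem one_lt_deriv_re {j : ℤ} {z : ℂ} (hz : z ∈ leftStrip j) :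
    1 < (1 - Complex.exp (-z)).re := by
  have := cos_im_neg_of_mem_leftStrip hz
  simp only [Complex.sub_re, Complex.one_re, Complex.exp_re, Complex.neg_re, Complex.neg_im,
    Real.cos_neg]
  nlinarith [Real.exp_pos (-z.re)]

/-- Noshiro–Warschawski: the derivative has positive real part on a convex set, so the image
strictly advances in the direction of `w - z` along the segment. -/
theorem injOn_fatouFunction_leftStrip (j : ℤ) : InjOn fatouFunction (leftStrip j) := by
  intro z hz w hw h
  by_contra hne
  set d := w - z with hd
  have hd0 : 0 < Complex.normSq d := Complex.normSq_pos.2 (sub_ne_zero.2 (Ne.symm hne))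
  have hder : ∀ t : ℝ, HasDerivAt
      (fun t : ℝ => (fatouFunction (z + t * d) * (starRingEnd ℂ) d).re)
      ((1 - Complex.exp (-(z + t * d))).re * Complex.normSq d) t := by
    intro t
    have h1 : HasDerivAt (fun s : ℂ => z + s * d) d t := by
      simpa using ((hasDerivAt_id (t : ℂ)).mul_const d).const_add z
    have h2 := (((hasDerivAt_fatouFunction _).comp (t : ℂ) h1).mul_const
      ((starRingEnd ℂ) d)).real_of_complex
    rw [mul_assoc, Complex.mul_conj, Complex.re_mul_ofReal] at h2
    exact h2
  have hmono : StrictMonoOn (fun t : ℝ => (fatouFunction (z + t * d) * (starRingEnd ℂ) d).re)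
      (Icc 0 1) := by
    refine strictMonoOn_of_deriv_pos (convex_Icc 0 1)
      (fun t _ => (hder t).continuousAt.continuousWithinAt) fun t ht => ?_
    rw [interior_Icc] at ht
    rw [(hder t).deriv]
    have hmem : z + t * d ∈ leftStrip j := by
      have := (convex_leftStrip j).add_smul_sub_mem hz hw ⟨ht.1.le, ht.2.le⟩
      simpa using this
    exact mul_pos (by linarith [one_lt_deriv_re hmem]) hd0
  have := hmono (left_mem_Icc.2 zero_le_one) (right_mem_Icc.2 zero_le_one) zero_lt_one
  simp [hd, h] at this

theorem exists_leftStrip_inverse (j : ℤ) : ∃ ψ : ℂ → ℂ,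
    (∀ z ∈ leftStrip j, ψ (fatouFunction z) = z) ∧
    ∀ z ∈ leftStrip j, ContinuousAt ψ (fatouFunction z) := by
  have hleft := (injOn_fatouFunction_leftStrip j).leftInvOn_invFunOn
  refine ⟨Function.invFunOn fatouFunction (leftStrip j), hleft, fun z hz => ?_⟩
  have hd : HasStrictDerivAt fatouFunction (1 - Complex.exp (-z)) z := by
    have := (differentiable_fatouFunction.analyticAt z).hasStrictDerivAt
    rwa [(hasDerivAt_fatouFunction z).deriv] at this
  have hne : 1 - Complex.exp (-z) ≠ 0 := by
    intro h
    have := one_lt_deriv_re hz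
    rw [h, Complex.zero_re] at this
    linarith
  rw [ContinuousAt, ← hd.map_nhds_eq hne, tendsto_map'_iff, hleft hz]
  refine tendsto_id.congr' ?_
  filter_upwards [(isOpen_leftStrip j).mem_nhds hz] with y hy
  exact (hleft hy).symm

/-- Taking logarithms, the equation becomes `z = c * I - log (z + 1 - w)`, with `c` the centre
height of the strip. The right side is a contraction of a rectangle on which `z + 1 - w` has real
part at least 2. -/
theorem exists_mem_leftStrip_eq {r : ℝ} (hr : 100 ≤ r) {j : ℤ}
    (hj : |(2 * j + 1) * Real.pi| ≤ r) {w : ℂ} (hw : w.re ≤ 1 - r) (hw' : |w.im| ≤ r) :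
    ∃ z ∈ leftStrip j, fatouFunction z = w := by
  set c : ℝ := (2 * j + 1) * Real.pi with hc
  have hpi := Real.pi_pos
  have hpi4 := Real.pi_le_four
  rw [abs_le] at hj hw'
  let D : Set ℂ := Icc (w.re + 1) 0 ×ℂ Icc (c - Real.pi / 2) (c + Real.pi / 2)
  have hD : ∀ z, z ∈ D ↔ (w.re + 1 ≤ z.re ∧ z.re ≤ 0) ∧
      (c - Real.pi / 2 ≤ z.im ∧ z.im ≤ c + Real.pi / 2) := fun z => by
    simp [D, Complex.mem_reProdIm]
  let Φ : ℂ → ℂ := fun z => c * Complex.I - Complex.log (z + 1 - w)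
  have hq : ∀ z ∈ D, 2 ≤ (z + 1 - w).re := by
    intro z hz
    have := ((hD z).1 hz).1.1
    simp
    linarith
  have hΦim : ∀ z ∈ D, |(Complex.log (z + 1 - w)).im| < Real.pi / 2 := by
    intro z hz
    rw [Complex.log_im, Complex.abs_arg_lt_pi_div_two_iff]
    exact Or.inl (by linarith [hq z hz])
  have hmaps : MapsTo Φ D D := by
    intro z hz
    have h2 := hq z hz
    have h3 := abs_lt.1 (hΦim z hz)
    have hn : 2 ≤ ‖z + 1 - w‖ := h2.trans (Complex.re_le_norm _)
    obtain ⟨⟨ha, hb⟩, hc1, hc2⟩ := (hD z).1 hz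
    have hre : (Φ z).re = -Real.log ‖z + 1 - w‖ := by simp [Φ, Complex.log_re]
    have him : (Φ z).im = c - (Complex.log (z + 1 - w)).im := by simp [Φ]
    rw [hD, hre, him]
    refine ⟨⟨?_, ?_⟩, by linarith, by linarith⟩
    · have h4 := Complex.norm_le_abs_re_add_abs_im (z + 1 - w)
      have h5 : |(z + 1 - w).re| ≤ 1 - w.re := by
        rw [abs_of_nonneg (by linarith)]
        simp
        linarith
      have h6 : |(z + 1 - w).im| ≤ 2 * r + 2 := by
        simp only [Complex.sub_im, Complex.add_im, Complex.one_im]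
        exact abs_le.2 ⟨by linarith, by linarith⟩
      have h7 := eight_mul_le_exp (x := -w.re - 1) (by linarith)
      have h8 : Real.log ‖z + 1 - w‖ ≤ -w.re - 1 :=
        (Real.log_le_iff_le_exp (by linarith)).2 (by linarith)
      linarith
    · linarith [Real.log_nonneg (by linarith : 1 ≤ ‖z + 1 - w‖)]
  have hconv : Convex ℝ D := by
    have hset : D = (Complex.reLm ⁻¹' Icc (w.re + 1) 0) ∩
        (Complex.imLm ⁻¹' Icc (c - Real.pi / 2) (c + Real.pi / 2)) := rfl
    rw [hset]
    exact ((convex_Icc _ _).linear_preimage _).inter ((convex_Icc _ _).linear_preimage _)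
  have hclosed : IsClosed D := isClosed_Icc.reProdIm isClosed_Icc
  have hder : ∀ z ∈ D, HasDerivWithinAt Φ (-(1 / (z + 1 - w))) D z := by
    intro z hz
    have h1 : HasDerivAt (fun z : ℂ => z + 1 - w) 1 z :=
      ((hasDerivAt_id z).add_const 1).sub_const w
    exact ((h1.clog (Or.inl (by linarith [hq z hz]))).const_sub _).hasDerivWithinAt
  have hlip : LipschitzOnWith (1 / 2) Φ D := by
    refine hconv.lipschitzOnWith_of_nnnorm_hasDerivWithin_le hder fun z hz => ?_
    rw [← NNReal.coe_le_coe]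
    simp only [coe_nnnorm, norm_neg, norm_div, norm_one]
    push_cast
    exact one_div_le_one_div_of_le two_pos ((hq z hz).trans (Complex.re_le_norm _))
  have hctr : ContractingWith (1 / 2) (hmaps.restrict Φ D D) :=
    ⟨by rw [← NNReal.coe_lt_coe]; norm_num, hlip.mapsToRestrict hmaps⟩
  have h0 : (c * Complex.I : ℂ) ∈ D := by
    rw [hD]
    simp
    refine ⟨by linarith, by linarith⟩
  obtain ⟨z, hzD, hzfix, -⟩ :=
    hctr.exists_fixedPoint' hclosed.isComplete hmaps h0 (edist_ne_top _ _)
  have hzfix' : c * Complex.I - Complex.log (z + 1 - w) = z := hzfix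
  have h3 := abs_lt.1 (hΦim z hzD)
  have hzim : z.im = c - (Complex.log (z + 1 - w)).im := by
    conv_lhs => rw [← hzfix']
    simp
  refine ⟨z, ⟨by rw [hzim, hc]; linarith, by rw [hzim, hc]; linarith⟩, ?_⟩
  have hq0 : z + 1 - w ≠ 0 := by
    intro h
    have := hq z hzD
    rw [h, Complex.zero_re] at this
    linarith
  have hexp : Complex.exp (-z) = -(z + 1 - w) := by
    have h4 : -z = Complex.log (z + 1 - w) + (-(Real.pi * Complex.I) +
        (-j : ℤ) * (2 * Real.pi * Complex.I)) := by
      rw [hc] at hzfix'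
      push_cast at hzfix' ⊢
      linear_combination hzfix'
    rw [h4, Complex.exp_add, Complex.exp_add, Complex.exp_log hq0,
      Complex.exp_int_mul_two_pi_mul_I, Complex.exp_neg, Complex.exp_pi_mul_I]
    norm_num
  rw [fatouFunction, hexp]
  ring

/-! ### Deforming the domains into squares. -/

/-- The part of `stayDomain 1 X` to the left of the square is invariant under small shifts to
the right. -/
theorem add_mem_stayDomain_one {X : ℕ → ℝ} (hX : IsRadiusSeq X) {z : ℂ} (hz : z ∈ stayDomain 1 X)
    {s : ℝ} (hs : 0 ≤ s) (hs' : z.re + s ≤ 1 - X 0) : z + s ∈ stayDomain 1 X := by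
  have h6 := hX.six_le 0
  have h7 := hX.exp_add_le 0
  have h8 := hX.add_one_le 0
  have hlow := re_of_mem_stayDomain hX hz
  obtain ⟨⟨h1, h2⟩, ⟨h3, h4⟩, h5⟩ := hz
  simp only [zero_add, fatouFunction_re, fatouFunction_im] at h3 h4 h5 h7 h8
  have hstrip : z + s ∈ halfStrip (X 0) := ⟨by simp; linarith, by simpa using h2⟩
  refine ⟨hstrip, ?_⟩
  by_cases hx : -X 0 ≤ z.re + s
  · exact fatouFunction_mem_box (hX.exp_add_le 0) hstrip (by simpa using hx)
  push Not at hx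
  have hE : Real.exp (-(z.re + s)) * Real.exp s = Real.exp (-z.re) := by
    rw [← Real.exp_add]; ring_nf
  set a := Real.exp (-(z.re + s)) with ha
  set b := Real.exp (-z.re) with hb
  have ha0 : 0 < a := Real.exp_pos _
  have hes := Real.add_one_le_exp s
  have hab : a ≤ b := by rw [← hE]; nlinarith
  simp only [mem_preimage]
  rw [abs_lt] at h2 h4
  refine ⟨⟨?_, ?_⟩, ?_⟩
  · simp only [fatouFunction_re, Complex.add_re, Complex.add_im, Complex.ofReal_re,
      Complex.ofReal_im, add_zero, ← ha]
    -- Shifting adds `s` but divides the cosine term by `exp s`; if that term still exceeds 1, the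
    -- loss is at least `s`.
    by_cases hcos : a * Real.cos z.im ≤ 1
    · linarith
    · have : a * Real.cos z.im * (1 + s) ≤ b * Real.cos z.im := by
        rw [← hE]
        nlinarith
      nlinarith
  · simp only [fatouFunction_im, Complex.add_re, Complex.add_im, Complex.ofReal_re,
      Complex.ofReal_im, add_zero, ← ha]
    rw [abs_lt]
    rcases le_total 0 (Real.sin z.im) with h | h <;> constructor <;> nlinarith
  · simp only [fatouFunction_re, Complex.add_re, Complex.add_im, Complex.ofReal_re,
      Complex.ofReal_im, add_zero, ← ha]
    rcases le_total 0 (Real.cos z.im) with h | h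
    · nlinarith
    · nlinarith

/-- A deformation of `stayDomain n X` into the square, fixing all points far enough to the
right. -/
structure IsPush (n : ℕ) (X : ℕ → ℝ) (H : ℝ → ℂ → ℂ) : Prop where
  continuousAt : ∀ t, ∀ z ∈ stayDomain n X, ContinuousAt (fun p : ℝ × ℂ => H p.1 p.2) (t, z)
  zero : ∀ z ∈ stayDomain n X, H 0 z = z
  mem : ∀ t, ∀ z ∈ stayDomain n X, H t z ∈ stayDomain n X
  one : ∀ z ∈ stayDomain n X, H 1 z ∈ box (X 0)
  eq_self : ∀ t, ∀ z ∈ stayDomain n X, 1 - X 0 ≤ z.re → H t z = z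
  re_le : ∀ t, ∀ z ∈ stayDomain n X, z.re ≤ 1 - X 0 → (H t z).re ≤ 1 - X 0

theorem IsPush.of_zero (X : ℕ → ℝ) : IsPush 0 X (fun _ z => z) :=
  ⟨fun _ _ _ => continuous_snd.continuousAt, fun _ _ => rfl, fun _ _ h => h, fun _ h => h,
    fun _ _ _ _ => rfl, fun _ _ _ h => h⟩

theorem left_of_mem_stayDomain_succ {X : ℕ → ℝ} (hX : IsRadiusSeq X) {n : ℕ} {z : ℂ}
    (hz : z ∈ stayDomain (n + 1) X) (h : (fatouFunction z).re ≤ 1 - X 1) :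
    Real.cos z.im < 0 ∧ z.re ≤ -X 0 := by
  have h1 := re_of_mem_stayDomain hX hz
  have h2 : Real.exp (X 0) + X 0 + 1 ≤ X 1 := hX.exp_add_le 0
  have h3 := Real.exp_pos (X 0)
  have h4 := Real.exp_pos (-z.re)
  rw [fatouFunction_re] at h
  have hcos : Real.cos z.im < 0 := by
    by_contra! hc
    have : X 0 + 1 ≤ Real.exp (X 0) := Real.add_one_le_exp _
    nlinarith [mul_nonneg h4.le hc, hX.six_le 0]
  refine ⟨hcos, ?_⟩
  have h5 : Real.exp (X 0) ≤ Real.exp (-z.re) := by nlinarith [Real.neg_one_le_cos z.im]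
  linarith [Real.exp_le_exp.1 h5]

/-- The lines `|im z| = r` avoid every left strip, as `r` is a multiple of `2π`. -/
theorem leftStrip_subset_of_mem {r : ℝ} (hr : ∃ k : ℕ, r = k * (2 * Real.pi)) {j : ℤ} {z : ℂ}
    (hz : z ∈ leftStrip j) (hzr : |z.im| < r) :
    (∀ w ∈ leftStrip j, |w.im| < r) ∧ |(2 * j + 1) * Real.pi| ≤ r := by
  obtain ⟨k, rfl⟩ := hr
  have hpi := Real.pi_pos
  rw [abs_lt] at hzr
  obtain ⟨h1, h2⟩ := hz
  have hjk : (j : ℝ) < k := by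
    by_contra! h
    nlinarith
  have hjk' : -(k : ℝ) < j + 1 := by
    by_contra! h
    nlinarith
  have hjk1 : (j : ℝ) + 1 ≤ k := by
    have : j < (k : ℤ) := by exact_mod_cast hjk
    exact_mod_cast Int.add_one_le_iff.2 this
  have hjk2 : -(k : ℝ) ≤ j := by
    have : -(k : ℤ) < j + 1 := by exact_mod_cast hjk'
    exact_mod_cast Int.lt_add_one_iff.1 this
  refine ⟨fun w hw => abs_lt.2 ⟨?_, ?_⟩, abs_le.2 ⟨?_, ?_⟩⟩
  · nlinarith [hw.1]
  · nlinarith [hw.2]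
  · nlinarith
  · nlinarith

/-- Truncation of a real parameter to the unit interval. -/
noncomputable def unitClamp (t : ℝ) : ℝ := max 0 (min 1 t)

/-- Lift the given push through the inverse branches, which ends in `stayDomain 1 X`, then slide
horizontally into the square. -/
theorem IsPush.succ {n : ℕ} {X : ℕ → ℝ} (hX : IsRadiusSeq X) {H : ℝ → ℂ → ℂ}
    (hH : IsPush n (fun i => X (i + 1)) H) : ∃ H', IsPush (n + 1) X H' := by
  classical
  choose ψ hψ hψc using exists_leftStrip_inverse
  have hX1 : 100 ≤ X 1 := by
    have h1 : Real.exp (X 0) + X 0 + 1 ≤ X 1 := hX.exp_add_le 0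
    linarith [eight_mul_le_exp (hX.six_le 0), hX.six_le 0]
  have h01 : X 0 ≤ X 1 := by linarith [hX.add_one_le 0]
  have hlift : ∀ t, ∀ z ∈ stayDomain (n + 1) X, (fatouFunction z).re ≤ 1 - X 1 →
      ∀ j, z ∈ leftStrip j → ∃ z' ∈ leftStrip j, fatouFunction z' = H t (fatouFunction z) ∧
        z' ∈ stayDomain (n + 1) X ∧ z'.re ≤ -X 0 := by
    intro t z hz hzl j hj
    obtain ⟨hsub, hjr⟩ := leftStrip_subset_of_mem (hX.exists_nat 0) hj hz.1.2
    have hw := hH.mem t _ hz.2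
    have hwl : (H t (fatouFunction z)).re ≤ 1 - X 1 := hH.re_le t _ hz.2 hzl
    obtain ⟨z', hz', hfz'⟩ := exists_mem_leftStrip_eq hX1 (hjr.trans h01) hwl
      (stayDomain_subset_halfStrip _ _ hw).2.le
    have hz'S : z' ∈ stayDomain (n + 1) X := by
      refine ⟨⟨?_, hsub z' hz'⟩, by rwa [mem_preimage, hfz']⟩
      by_contra! h
      have := add_half_le_fatouFunction_re (z := z') (by linarith [hX.six_le 0])
      rw [hfz'] at this
      linarith [hX.six_le 0]
    exact ⟨z', hz', hfz', hz'S, (left_of_mem_stayDomain_succ hX hz'S (by rwa [hfz'])).2⟩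
  let P : ℝ → ℂ → ℂ := fun t z => if 1 - X 1 ≤ (fatouFunction z).re then z else
    ψ ⌊z.im / (2 * Real.pi)⌋ (H t (fatouFunction z))
  -- Both formulas for `P` agree on left strips, because `H` fixes points to the right; hence
  -- continuity across the interface.
  have hPψ : ∀ t, ∀ z ∈ stayDomain (n + 1) X, ∀ j, z ∈ leftStrip j →
      P t z = ψ j (H t (fatouFunction z)) := by
    intro t z hz j hj
    by_cases h : 1 - X 1 ≤ (fatouFunction z).re
    · rw [hH.eq_self t _ hz.2 h, hψ j z hj]
      exact if_pos h
    · simp only [P, if_neg h, floor_of_mem_leftStrip hj]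
  have hPspec : ∀ t, ∀ z ∈ stayDomain (n + 1) X, (fatouFunction z).re ≤ 1 - X 1 →
      P t z ∈ stayDomain (n + 1) X ∧ (P t z).re ≤ -X 0 ∧ z.re ≤ -X 0 ∧
        fatouFunction (P t z) = H t (fatouFunction z) := by
    intro t z hz hzl
    obtain ⟨hcos, hre⟩ := left_of_mem_stayDomain_succ hX hz hzl
    obtain ⟨j, hj⟩ := exists_mem_leftStrip hcos
    obtain ⟨z', hz', hfz', hz'S, hz're⟩ := hlift t z hz hzl j hj
    have : P t z = z' := by rw [hPψ t z hz j hj, ← hfz', hψ j z' hz']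
    rw [this]
    exact ⟨hz'S, hz're, hre, hfz'⟩
  have hPcont : ∀ t, ∀ z ∈ stayDomain (n + 1) X,
      ContinuousAt (fun p : ℝ × ℂ => P p.1 p.2) (t, z) := by
    intro t z hz
    rcases lt_or_ge (1 - X 1) (fatouFunction z).re with h | h
    · refine continuous_snd.continuousAt.congr (f := fun p : ℝ × ℂ => p.2) ?_
      have ho : IsOpen {p : ℝ × ℂ | 1 - X 1 < (fatouFunction p.2).re} :=
        isOpen_lt continuous_const
          (Complex.continuous_re.comp (continuous_fatouFunction.comp continuous_snd))
      filter_upwards [ho.mem_nhds (show (t, z) ∈ _ from h)] with p hp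
      exact (if_pos (le_of_lt hp)).symm
    · obtain ⟨j, hj⟩ := exists_mem_leftStrip (left_of_mem_stayDomain_succ hX hz h).1
      obtain ⟨z', hz', hfz', -⟩ := hlift t z hz h j hj
      have hcont : ContinuousAt (fun p : ℝ × ℂ => ψ j (H p.1 (fatouFunction p.2))) (t, z) := by
        have h1 : ContinuousAt (fun p : ℝ × ℂ => H p.1 (fatouFunction p.2)) (t, z) :=
          ContinuousAt.comp (g := fun p : ℝ × ℂ => H p.1 p.2)
            (f := fun p : ℝ × ℂ => (p.1, fatouFunction p.2)) (hH.continuousAt t _ hz.2)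
            (continuous_fst.prodMk (continuous_fatouFunction.comp continuous_snd)).continuousAt
        refine ContinuousAt.comp (g := ψ j) ?_ h1
        rw [← hfz']
        exact hψc j z' hz'
      refine hcont.congr ?_
      have ho := (isOpen_stayDomain (n + 1) X).inter (isOpen_leftStrip j)
      filter_upwards [(ho.preimage continuous_snd).mem_nhds (show (t, z) ∈ _ from ⟨hz, hj⟩)]
        with p hp
      exact (hPψ p.1 p.2 hp.1 j hp.2).symm
  have hPright : ∀ t, ∀ z, 1 - X 1 ≤ (fatouFunction z).re → P t z = z := fun t z h => if_pos h
  have hPmem : ∀ t, ∀ z ∈ stayDomain (n + 1) X, P t z ∈ stayDomain (n + 1) X := by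
    intro t z hz
    rcases le_total (1 - X 1) (fatouFunction z).re with h | h
    · rwa [hPright t z h]
    · exact (hPspec t z hz h).1
  have hPself : ∀ t, ∀ z ∈ stayDomain (n + 1) X, 1 - X 0 ≤ z.re → P t z = z := by
    intro t z hz h
    refine hPright t z ?_
    by_contra! h'
    linarith [(left_of_mem_stayDomain_succ hX hz h'.le).2]
  have hPle : ∀ t, ∀ z ∈ stayDomain (n + 1) X, z.re ≤ 1 - X 0 → (P t z).re ≤ 1 - X 0 := by
    intro t z hz h
    rcases le_total (1 - X 1) (fatouFunction z).re with h' | h'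
    · rwa [hPright t z h']
    · linarith [(hPspec t z hz h').2.1]
  have hPone : ∀ z ∈ stayDomain (n + 1) X, P 1 z ∈ stayDomain 1 X := by
    intro z hz
    rcases le_total (1 - X 1) (fatouFunction z).re with h | h
    · rw [hPright 1 z h]
      exact ⟨hz.1, stayDomain_subset_halfStrip _ _ hz.2, by linarith⟩
    · obtain ⟨h1, -, -, h2⟩ := hPspec 1 z hz h
      refine ⟨h1.1, ?_⟩
      rw [mem_preimage, h2]
      exact hH.one _ hz.2
  let R : ℝ → ℂ → ℂ := fun s z => z + ((unitClamp s * max 0 (1 - X 0 - z.re) : ℝ) : ℂ)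
  have hclamp : Continuous unitClamp := by unfold unitClamp; fun_prop
  have hRcont : Continuous (fun p : ℝ × ℂ => R p.1 p.2) := by
    have h1 : Continuous fun p : ℝ × ℂ => p.2.re := Complex.continuous_re.comp continuous_snd
    have h2 : Continuous fun p : ℝ × ℂ => unitClamp p.1 := hclamp.comp continuous_fst
    exact continuous_snd.add (Complex.continuous_ofReal.comp
      (h2.mul (continuous_const.max (continuous_const.sub h1))))
  have hRself : ∀ (s : ℝ) (z : ℂ), 1 - X 0 ≤ z.re → R s z = z := by
    intro s z h
    simp [R, max_eq_left (by linarith : 1 - X 0 - z.re ≤ 0)]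
  have hclamp01 : ∀ s, 0 ≤ unitClamp s ∧ unitClamp s ≤ 1 := fun s =>
    ⟨le_max_left _ _, max_le zero_le_one (min_le_left _ _)⟩
  have hRnon : ∀ s, s ≤ 0 → ∀ z, R s z = z := by
    intro s hs z
    have : unitClamp s = 0 := max_eq_left ((min_le_right _ _).trans hs)
    simp [R, this]
  have hRre : ∀ (s : ℝ) (z : ℂ), z.re ≤ 1 - X 0 → unitClamp s * max 0 (1 - X 0 - z.re) ≤ 1 - X 0 - z.re := by
    intro s z h
    rw [max_eq_right (by linarith)]
    exact mul_le_of_le_one_left (by linarith) (hclamp01 s).2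
  have hRle : ∀ (s : ℝ) (z : ℂ), z.re ≤ 1 - X 0 → (R s z).re ≤ 1 - X 0 := by
    intro s z h
    simp only [R, Complex.add_re, Complex.ofReal_re]
    linarith [hRre s z h]
  have hRmem : ∀ s, ∀ z ∈ stayDomain 1 X, R s z ∈ stayDomain 1 X := by
    intro s z hz
    rcases le_total (1 - X 0) z.re with h | h
    · rwa [hRself s z h]
    · exact add_mem_stayDomain_one hX hz (mul_nonneg (hclamp01 s).1 (le_max_left _ _))
        (by linarith [hRre s z h])
  have hc1 : ∀ t, 1 ≤ t → unitClamp t = 1 := fun t ht => by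
    simp [unitClamp, min_eq_left ht]
  have hsub : stayDomain 1 X ⊆ stayDomain (n + 1) X := stayDomain_mono hX (by omega)
  -- The lift `P` runs for `t ≤ 1/2`, the slide `R` afterwards; clamping freezes each outside its
  -- time.
  refine ⟨fun t z => R (2 * t - 1) (P (unitClamp (2 * t)) z), ?_, ?_, ?_, ?_, ?_, ?_⟩
  · intro t z hz
    have h1 : ContinuousAt (fun p : ℝ × ℂ => P (unitClamp (2 * p.1)) p.2) (t, z) :=
      ContinuousAt.comp (g := fun p : ℝ × ℂ => P p.1 p.2)
        (f := fun p : ℝ × ℂ => (unitClamp (2 * p.1), p.2)) (hPcont _ z hz)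
        ((hclamp.comp (continuous_const.mul continuous_fst)).prodMk continuous_snd).continuousAt
    exact ContinuousAt.comp (g := fun p : ℝ × ℂ => R p.1 p.2)
      (f := fun p : ℝ × ℂ => (2 * p.1 - 1, P (unitClamp (2 * p.1)) p.2)) hRcont.continuousAt
      ((by fun_prop : Continuous fun p : ℝ × ℂ => 2 * p.1 - 1).continuousAt.prodMk h1)
  · intro z hz
    have h0 : unitClamp (2 * 0) = 0 := by simp [unitClamp]
    simp only [h0]
    rw [hRnon _ (by norm_num)]
    rcases le_total (1 - X 1) (fatouFunction z).re with h | h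
    · exact hPright 0 z h
    · obtain ⟨j, hj⟩ := exists_mem_leftStrip (left_of_mem_stayDomain_succ hX hz h).1
      rw [hPψ 0 z hz j hj, hH.zero _ hz.2, hψ j z hj]
  · intro t z hz
    rcases le_total (2 * t) 1 with h | h
    · rw [hRnon _ (by linarith)]
      exact hPmem _ z hz
    · simp only [hc1 _ h]
      exact hsub (hRmem _ _ (hPone z hz))
  · intro z hz
    have h1 : unitClamp (2 * 1) = 1 := hc1 _ (by norm_num)
    have h2 : unitClamp (2 * 1 - 1) = 1 := hc1 _ (by norm_num)
    have hmem := hRmem (2 * 1 - 1) _ (hPone z hz)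
    simp only [h1]
    refine ⟨hmem.1, ?_⟩
    simp only [R, h2, one_mul, Complex.add_re, Complex.ofReal_re]
    linarith [le_max_right 0 (1 - X 0 - (P 1 z).re)]
  · intro t z hz h
    rw [hPself _ z hz h, hRself _ z h]
  · intro t z hz h
    exact hRle _ _ (hPle _ z hz h)

theorem exists_isPush (n : ℕ) {X : ℕ → ℝ} (hX : IsRadiusSeq X) : ∃ H, IsPush n X H := by
  induction n generalizing X with
  | zero => exact ⟨_, IsPush.of_zero X⟩
  | succ n ih =>
    obtain ⟨H, hH⟩ := ih hX.shift
    exact hH.succ hX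

theorem convex_box (r : ℝ) : Convex ℝ (box r) := by
  have h : box r = ({z : ℂ | z.re < r} ∩ ({z | -r < z.im} ∩ {z | z.im < r})) ∩ {z | -r < z.re} := by
    ext z
    simp [box, halfStrip, abs_lt]
  rw [h]
  exact ((convex_halfSpace_re_lt _).inter ((convex_halfSpace_im_gt _).inter
    (convex_halfSpace_im_lt _))).inter (convex_halfSpace_re_gt _)

theorem isSimplyConnected_stayDomain (n : ℕ) {X : ℕ → ℝ} (hX : IsRadiusSeq X) :
    IsSimplyConnected (stayDomain n X) := by
  obtain ⟨H, hH⟩ := exists_isPush n hX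
  have hbox : box (X 0) ⊆ stayDomain n X := stayDomain_mono hX n.zero_le
  have h0 : (0 : ℂ) ∈ box (X 0) := by
    have := hX.six_le 0
    refine ⟨⟨?_, ?_⟩, ?_⟩ <;> simp <;> linarith
  let F₁ : ContinuousMap.Homotopy (ContinuousMap.id (stayDomain n X))
      ⟨fun z => ⟨H 1 z, hH.mem 1 z z.2⟩, by
        refine Continuous.subtype_mk (continuous_iff_continuousAt.2 fun z => ?_) _
        exact ContinuousAt.comp (g := fun p : ℝ × ℂ => H p.1 p.2)
          (f := fun z : stayDomain n X => ((1 : ℝ), (z : ℂ))) (hH.continuousAt 1 z z.2)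
          (by fun_prop)⟩ :=
    { toFun := fun p => ⟨H p.1 p.2, hH.mem p.1 p.2 p.2.2⟩
      continuous_toFun := by
        refine Continuous.subtype_mk (continuous_iff_continuousAt.2 fun p => ?_) _
        exact ContinuousAt.comp (g := fun p : ℝ × ℂ => H p.1 p.2)
          (f := fun p : unitInterval × stayDomain n X => ((p.1 : ℝ), (p.2 : ℂ)))
          (hH.continuousAt p.1 p.2 p.2.2) (by fun_prop)
      map_zero_left := fun z => Subtype.ext (hH.zero z z.2)
      map_one_left := fun z => rfl }
  have hmem : ∀ (s : unitInterval) (z : stayDomain n X),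
      (((1 - s : ℝ) : ℂ) * H 1 z) ∈ box (X 0) := by
    intro s z
    have := (convex_box (X 0)) (hH.one z z.2) h0 (a := 1 - s) (b := s)
      (by linarith [s.2.2]) s.2.1 (by ring)
    simpa using this
  let F₂ : ContinuousMap.Homotopy
      (⟨fun z => ⟨H 1 z, hH.mem 1 z z.2⟩, by
        refine Continuous.subtype_mk (continuous_iff_continuousAt.2 fun z => ?_) _
        exact ContinuousAt.comp (g := fun p : ℝ × ℂ => H p.1 p.2)
          (f := fun z : stayDomain n X => ((1 : ℝ), (z : ℂ))) (hH.continuousAt 1 z z.2)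
          (by fun_prop)⟩ : C(stayDomain n X, stayDomain n X))
      (ContinuousMap.const _ ⟨0, hbox h0⟩) :=
    { toFun := fun p => ⟨((1 - p.1 : ℝ) : ℂ) * H 1 p.2, hbox (hmem p.1 p.2)⟩
      continuous_toFun := by
        refine Continuous.subtype_mk (Continuous.mul (by fun_prop) ?_) _
        refine continuous_iff_continuousAt.2 fun p => ?_
        exact ContinuousAt.comp (g := fun p : ℝ × ℂ => H p.1 p.2)
          (f := fun p : unitInterval × stayDomain n X => ((1 : ℝ), (p.2 : ℂ)))
          (hH.continuousAt 1 p.2 p.2.2) (by fun_prop)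
      map_zero_left := fun z => Subtype.ext (by simp)
      map_one_left := fun z => Subtype.ext (by simp) }
  have : ContractibleSpace (stayDomain n X) :=
    (contractible_iff_id_nullhomotopic _).2 ⟨⟨0, hbox h0⟩, ⟨F₁.trans F₂⟩⟩
  exact SimplyConnectedSpace.ofContractible _

theorem isSimplyConnected_stayRegion {X : ℕ → ℝ} (hX : IsRadiusSeq X) :
    IsSimplyConnected (stayRegion X) :=
  isSimplyConnected_iUnion_of_isOpen (stayDomain_mono hX) (fun n => isOpen_stayDomain n X)
    fun n => isSimplyConnected_stayDomain n hX

/-! ### Assembling the web. -/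

/-- The radius sequence with first term `2πk`. -/
noncomputable def radiusSeq (k : ℕ) : ℕ → ℝ
  | 0 => k * (2 * Real.pi)
  | n + 1 => ⌈(Real.exp (radiusSeq k n) + radiusSeq k n + 1) / (2 * Real.pi)⌉₊ * (2 * Real.pi)

theorem isRadiusSeq_radiusSeq {k : ℕ} (hk : 1 ≤ k) : IsRadiusSeq (radiusSeq k) := by
  have hpi := Real.pi_pos
  have hpi3 := Real.pi_gt_three
  have hpi4 : Real.pi < 3.15 := Real.pi_lt_d2
  have h2pi : 0 < 2 * Real.pi := by positivity
  have hstep : ∀ n, Real.exp (radiusSeq k n) + radiusSeq k n + 1 ≤ radiusSeq k (n + 1) :=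
    fun n => (div_le_iff₀ h2pi).1 (Nat.le_ceil _)
  have hsix : ∀ n, 6 ≤ radiusSeq k n := by
    intro n
    induction n with
    | zero =>
      have : (1 : ℝ) ≤ k := by exact_mod_cast hk
      simp only [radiusSeq]
      nlinarith
    | succ n ih => linarith [hstep n, Real.exp_pos (radiusSeq k n)]
  refine ⟨fun n => ?_, hsix, hstep, fun n => ?_⟩
  · cases n with
    | zero => exact ⟨k, rfl⟩
    | succ n => exact ⟨_, rfl⟩
  · have h0 : 0 ≤ (Real.exp (radiusSeq k n) + radiusSeq k n + 1) / (2 * Real.pi) := by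
      have := hsix n
      positivity
    -- Rounding up adds less than `2π < 7`, whence the constant 8.
    have h1 := mul_lt_mul_of_pos_right (Nat.ceil_lt_add_one h0) h2pi
    rw [add_mul, div_mul_cancel₀ _ h2pi.ne', one_mul] at h1
    have h2 : radiusSeq k (n + 1) =
      ⌈(Real.exp (radiusSeq k n) + radiusSeq k n + 1) / (2 * Real.pi)⌉₊ * (2 * Real.pi) := rfl
    rw [h2]
    linarith

theorem radiusSeq_mono {k l : ℕ} (h : k ≤ l) (n : ℕ) : radiusSeq k n ≤ radiusSeq l n := by
  have hpi := Real.pi_pos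
  induction n with
  | zero => simp only [radiusSeq]; gcongr
  | succ n ih => simp only [radiusSeq]; gcongr

/-- This real point on the right edge ties the frontier to the half-plane in the web. -/
theorem mem_frontier_stayRegion {X : ℕ → ℝ} (hX : IsRadiusSeq X) :
    (X 0 : ℂ) ∈ frontier (stayRegion X) := by
  have h6 := hX.six_le 0
  rw [(isOpen_stayRegion X).frontier_eq]
  refine ⟨?_, fun h => ?_⟩
  · have h1 : Tendsto (fun t : ℝ => (t : ℂ)) (𝓝[<] (X 0)) (𝓝 (X 0 : ℂ)) :=
      Complex.continuous_ofReal.continuousAt.tendsto.mono_left nhdsWithin_le_nhds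
    refine mem_closure_of_tendsto h1 ?_
    filter_upwards [Ioo_mem_nhdsLT (by linarith : 0 < X 0)] with t ht
    refine box_subset_stayRegion X ⟨⟨?_, ?_⟩, ?_⟩
    · simpa using ht.2
    · simp; linarith
    · simp; linarith [ht.1]
  · have := (stayRegion_subset_halfStrip X h).1
    simp at this

theorem theorem1p2 (m : ℕ) :
    ∃ E : Set ℂ, IsSpidersWeb E ∧
      E ⊆ uniformEscapingSet fatouFunction (fun n : ℕ => ((n : ℝ) + (m : ℝ)) / 2) := by
  let X : ℕ → ℕ → ℝ := fun k => radiusSeq (m + k + 1)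
  have hX : ∀ k, IsRadiusSeq (X k) := fun k => isRadiusSeq_radiusSeq (by omega)
  have hX0 : ∀ k, (m : ℝ) + k + 1 ≤ X k 0 := by
    intro k
    have hpi := Real.pi_gt_three
    have : (0 : ℝ) ≤ (m : ℝ) + k + 1 := by positivity
    simp only [X, radiusSeq]
    push_cast
    nlinarith
  have hm0 : (0 : ℝ) ≤ m := m.cast_nonneg
  let A : Set ℂ := {z | (m : ℝ) + 1 ≤ z.re}
  have hA : IsPreconnected A := (convex_halfSpace_re_ge _).isPreconnected
  have hmemA : ∀ k, (X k 0 : ℂ) ∈ A := fun k => by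
    have hk : (0 : ℝ) ≤ k := k.cast_nonneg
    show (m : ℝ) + 1 ≤ (X k 0 : ℂ).re
    rw [Complex.ofReal_re]
    linarith [hX0 k]
  have hfr : ∀ k, IsPreconnected (frontier (stayRegion (X k))) := fun k =>
    isPreconnected_frontier_stayRegion (hX k)
      (isSimplyConnected_stayRegion (hX k)).isPathConnected.isConnected.isPreconnected
  have hconn : IsConnected (⋃ k, (A ∪ frontier (stayRegion (X k)))) := by
    refine ⟨⟨X 0 0, mem_iUnion.2 ⟨0, Or.inl (hmemA 0)⟩⟩, ?_⟩
    refine isPreconnected_iUnion ⟨X 0 0, mem_iInter.2 fun k => Or.inl (hmemA 0)⟩ fun k => ?_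
    exact hA.union (X k 0 : ℂ) (hmemA k) (mem_frontier_stayRegion (hX k)) (hfr k)
  refine ⟨⋃ k, (A ∪ frontier (stayRegion (X k))), ⟨hconn, fun k => stayRegion (X k),
    fun k => ⟨isOpen_stayRegion _, isSimplyConnected_stayRegion (hX k),
      isBounded_stayRegion (hX k)⟩, fun k => stayRegion_mono (radiusSeq_mono (by omega)),
    fun k z hz => mem_iUnion.2 ⟨k, Or.inr hz⟩, ?_⟩, ?_⟩
  · refine eq_univ_of_forall fun z => ?_
    obtain ⟨k, hk⟩ := exists_nat_gt ‖z‖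
    have hre := abs_lt.1 ((Complex.abs_re_le_norm z).trans_lt hk)
    have him := (Complex.abs_im_le_norm z).trans_lt hk
    have := hX0 k
    exact mem_iUnion.2 ⟨k, box_subset_stayRegion _
      ⟨⟨by linarith, by linarith⟩, by linarith⟩⟩
  · refine iUnion_subset fun k => union_subset (fun z hz => ?_) ?_
    · have hz' : (m : ℝ) + 1 ≤ z.re := hz
      exact uniformEscaping_of_right (by linarith) (by linarith)
    · have hk : (0 : ℝ) ≤ k := k.cast_nonneg
      exact frontier_stayRegion_subset (hX k) (by linarith [hX0 k])
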